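/- Let $\mathcal I$ be a finite set of firms, let $\theta,\delta,\lambda>0$ and $\nu\in\mathbb R$. Firm $i\in\mathcal I$ chooses a quantity $x_i\in\mathbb R$; its cost is $\ell_i(x)=-x_i\bigl(\theta-\delta\sum_{j}x_j\bigr)+\nu x_i$, and under an incentive vector $p\in\mathbb R^{\mathcal I}$ its total cost is $c_i(x,p)=\ell_i(x)+p_ix_i$. A profile $x$ is a Nash equilibrium under $p$ if no firm can lower $c_i$ by changing $x_i\in\mathbb R$ alone. The social cost is $\Phi(x)=\sum_i\ell_i(x)+\lambda\sum_i x_i^2$, and a profile is socially optimal if it minimizes $\Phi$ over $\mathbb R^{\mathcal I}$. The externality is $e_i(x)=\partial_{x_i}\Phi(x)-\partial_{x_i}\ell_i(x)$. Then for every $p\in\mathbb R^{\mathcal I}$ there is a unique Nash equilibrium $x^*(p)$, there is a unique socially optimal profile $x^\dagger$, there is a unique $p^\dagger\in\mathbb R^{\mathcal I}$ with $p^\dagger=e(x^*(p^\dagger))$, and $x^*(p^\dagger)=x^\dagger$. Moreover, suppose $\lambda>\delta$. Let $(\gamma_k)_{k\ge1}$, $(\beta_k)_{k\ge1}$ be sequences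 in $(0,1)$ with $\sum_k\gamma_k=\sum_k\beta_k=+\infty$, $\sum_k(\gamma_k^2+\beta_k^2)<\infty$ and $\lim_{k\to\infty}\beta_k/\gamma_k=0$. Then, for arbitrary $x_1,p_1\in\mathbb R^{\mathcal I}$, the sequences defined for all $k\ge1$ and $i\in\mathcal I$ by $$x_{i,k+1}=(1-\gamma_k)x_{i,k}+\gamma_k\,\frac{\theta-\delta\sum_{j\ne i}x_{j,k}-\nu-p_{i,k}}{2\delta},\qquad p_{i,k+1}=(1-\beta_k)p_{i,k}+\beta_k\Bigl(\delta\sum_{j\ne i}x_{j,k}+2\lambda x_{i,k}\Bigr)$$ satisfy $\lim_{k\to\infty}(x_k,p_k)=(x^\dagger,p^\dagger)$. -/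

import Mathlib

open Filter Topology

namespace Cournot

variable {I : Type*} [Fintype I]

/-- Price of the good when the production profile is `x`. -/
def price (θ δ : ℝ) (x : I → ℝ) : ℝ := θ - δ * ∑ i, x i

/-- Cost (negative profit) of firm `i`, without incentives. -/
def firmCost (θ δ ν : ℝ) (i : I) (x : I → ℝ) : ℝ :=
  -(x i * price θ δ x) + ν * x i

/-- Total cost of firm `i` when it is charged the linear payment `p i * x i`. -/
def totalCost (θ δ ν : ℝ) (p : I → ℝ) (i : I) (x : I → ℝ) : ℝ :=
  firmCost θ δ ν i x + p i * x i

/-- Social cost: aggregate cost of the firms plus `lam` times the quadratic environmental cost. -/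
def socialCost (θ δ ν lam : ℝ) (x : I → ℝ) : ℝ :=
  ∑ i, firmCost θ δ ν i x + lam * ∑ i, x i ^ 2

/-- The social cost only depends on the total and on the sum of squares. -/
theorem socialCost_eq (θ δ ν lam : ℝ) (x : I → ℝ) : socialCost θ δ ν lam x =
    -((∑ i, x i) * (θ - δ * ∑ i, x i)) + ν * ∑ i, x i + lam * ∑ i, x i ^ 2 := by
  simp only [socialCost, firmCost, price, Finset.sum_add_distrib, Finset.sum_neg_distrib,
    ← Finset.sum_mul, ← Finset.mul_sum]

/-- `x` is socially optimal: it minimizes the social cost. -/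
def IsSociallyOptimal (θ δ ν lam : ℝ) (x : I → ℝ) : Prop :=
  ∀ y : I → ℝ, socialCost θ δ ν lam x ≤ socialCost θ δ ν lam y

variable [DecidableEq I]

/-- `x` is a Nash equilibrium of the game with incentive vector `p`. -/
def IsNash (θ δ ν : ℝ) (p x : I → ℝ) : Prop :=
  ∀ (i : I) (y : ℝ), totalCost θ δ ν p i x ≤ totalCost θ δ ν p i (Function.update x i y)

/-- The partial derivative of `f` at `x` with respect to the coordinate `i`. -/
noncomputable def partialDeriv (f : (I → ℝ) → ℝ) (i : I) (x : I → ℝ) : ℝ :=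
  deriv (fun t : ℝ => f (Function.update x i t)) (x i)

/-- Externality: marginal social cost minus marginal cost of firm `i`. -/
noncomputable def externality (θ δ ν lam : ℝ) (x : I → ℝ) : I → ℝ := fun i =>
  partialDeriv (socialCost θ δ ν lam) i x - partialDeriv (firmCost θ δ ν i) i x

/-- Best response of firm `i` to the profile `x` under the incentive vector `p`. -/
noncomputable def bestResponse (θ δ ν : ℝ) (p x : I → ℝ) (i : I) : ℝ :=
  (θ - δ * ∑ j ∈ Finset.univ.erase i, x j - ν - p i) / (2 * δ)

/-- Two-timescale step sizes: `γ` for the strategies, `β` for the incentives. Time is `k ≥ 1`. -/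
structure IsTwoTimescale (γ β : ℕ → ℝ) : Prop where
  strategy_mem : ∀ k, 1 ≤ k → γ k ∈ Set.Ioo (0 : ℝ) 1
  incentive_mem : ∀ k, 1 ≤ k → β k ∈ Set.Ioo (0 : ℝ) 1
  strategy_sum : Tendsto (fun N : ℕ => ∑ k ∈ Finset.Icc 1 N, γ k) atTop atTop
  incentive_sum : Tendsto (fun N : ℕ => ∑ k ∈ Finset.Icc 1 N, β k) atTop atTop
  summable_sq : Summable fun k : ℕ => γ (k + 1) ^ 2 + β (k + 1) ^ 2
  ratio : Tendsto (fun k : ℕ => β k / γ k) atTop (𝓝 0)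

/-- `(x k, p k)`, `k ≥ 1`, follows the joint strategy and incentive updates with step sizes
`γ` and `β`; the initial pair `(x 1, p 1)` is arbitrary. -/
structure IsLearningDynamics (θ δ ν lam : ℝ) (γ β : ℕ → ℝ) (x p : ℕ → I → ℝ) : Prop where
  strategy_update : ∀ k, 1 ≤ k → ∀ i,
    x (k + 1) i = (1 - γ k) * x k i + γ k * bestResponse θ δ ν (p k) (x k) i
  incentive_update : ∀ k, 1 ≤ k → ∀ i,
    p (k + 1) i = (1 - β k) * p k i +
      β k * (δ * ∑ j ∈ Finset.univ.erase i, x k j + 2 * lam * x k i)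

theorem sum_update (x : I → ℝ) (i : I) (t : ℝ) :
    ∑ j, Function.update x i t j = t + ∑ j ∈ Finset.univ.erase i, x j := by
  rw [← Finset.add_sum_erase _ _ (Finset.mem_univ i), Function.update_self]
  congr 1
  exact Finset.sum_congr rfl fun j hj => Function.update_of_ne (Finset.ne_of_mem_erase hj) _ _

/-- `bestResponse` is the unique minimizer of the total cost of firm `i` in its own quantity. -/
theorem isBestResponse_iff (θ δ ν : ℝ) (hδ : 0 < δ) (p x : I → ℝ) (i : I) (b : ℝ) :
    (∀ y : ℝ, totalCost θ δ ν p i (Function.update x i b) ≤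
      totalCost θ δ ν p i (Function.update x i y)) ↔ b = bestResponse θ δ ν p x i := by
  simp only [totalCost, firmCost, price, sum_update, Function.update_self, bestResponse]
  set s := ∑ j ∈ Finset.univ.erase i, x j
  have key : ∀ y c : ℝ, c = (θ - δ * s - ν - p i) / (2 * δ) →
      -(y * (θ - δ * (y + s))) + ν * y + p i * y = δ * (y - c) ^ 2 - δ * c ^ 2 := by
    rintro y c hc
    have h : 2 * δ * c = θ - δ * s - ν - p i := by rw [hc]; field_simp
    linear_combination y * h
  constructor
  · intro h
    have h1 := h ((θ - δ * s - ν - p i) / (2 * δ))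
    rw [key _ _ rfl, key _ _ rfl, sub_self] at h1
    have h2 : (b - (θ - δ * s - ν - p i) / (2 * δ)) ^ 2 ≤ 0 := by
      by_contra! h3
      nlinarith [mul_pos hδ h3]
    have h3 := pow_eq_zero_iff (two_ne_zero) |>.1 (le_antisymm h2 (sq_nonneg _))
    linarith
  · rintro rfl y
    rw [key _ _ rfl, key y _ rfl, sub_self]
    nlinarith [mul_nonneg hδ.le (sq_nonneg (y - (θ - δ * s - ν - p i) / (2 * δ)))]

/-- The closed form of the externality, as it is used in the incentive update. -/
theorem externality_eq (θ δ ν lam : ℝ) (x : I → ℝ) (i : I) :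
    externality θ δ ν lam x i = 2 * lam * x i + δ * ∑ j ∈ Finset.univ.erase i, x j := by
  have hsq : ∀ t : ℝ, ∑ j, Function.update x i t j ^ 2 =
      t ^ 2 + ∑ j ∈ Finset.univ.erase i, x j ^ 2 := by
    intro t
    rw [← Finset.add_sum_erase _ _ (Finset.mem_univ i), Function.update_self]
    congr 1
    exact Finset.sum_congr rfl fun j hj => by
      rw [Function.update_of_ne (Finset.ne_of_mem_erase hj)]
  simp only [externality, partialDeriv, socialCost_eq, firmCost, price, sum_update, hsq,
    Function.update_self]
  set s := ∑ j ∈ Finset.univ.erase i, x j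
  set q := ∑ j ∈ Finset.univ.erase i, x j ^ 2
  have hid := hasDerivAt_id' (x i)
  have ha := hid.add_const s
  have hp := (ha.const_mul δ).const_sub θ
  have h1 := (((ha.mul hp).neg.add (ha.const_mul ν)).add
    (((hid.pow 2).add_const q).const_mul lam)).deriv
  have h2 := ((hid.mul hp).neg.add (hid.const_mul ν)).deriv
  refine (congrArg₂ (· - ·) h1 h2).trans ?_
  norm_num
  ring

end Cournot

/-!
The game is quadratic, so each of the static claims is a linear system that decouples once it is
summed over the firms: equilibrium means `δ * x i + δ * ∑ j, x j = θ - ν - p i`, and completing the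
square shows that the constant profile `optimalQuantity` is the only minimizer of the social cost.
Inserting the externality for `p i` in the equilibrium equation gives the first-order condition of
the social optimum.

The learning dynamics is linear too. The operators that occur are combinations of the identity and
of `x ↦ ∑ j, x j`, so the aggregates `∑ j, x j`, `∑ j, p j`, centered at the optimum, and, for each
firm, the deviations `n * x i - ∑ j, x j`, `n * p i - ∑ j, p j` each solve a closed *scalar*
two-timescale recursion
`x (k + 1) = x k - γ k * a * (x k + κ * p k)`, `p (k + 1) = p k - β k * (p k - b * x k)`.
Such a recursion converges to zero when `0 < a`, `0 ≤ κ` and the reduced slow rate `1 + b * κ` is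
positive (`tendsto_zero_of_twoTimescale`): with the fast error `y = x + κ * p`, the weighted norm
`|p| + C * |y|`, for a small `C > 0`, is eventually multiplied at each step by at most
`1 - (1 + b * κ) / 2 * β k`. The error of order `β k` in the fast variable is absorbed by its
contraction of order `γ k`, because `β k / γ k → 0`; the product of these factors vanishes because
`∑ β k` diverges (`tendsto_zero_of_contraction`).
-/

open Filter Topology

namespace Cournot

/-! ### Linear two-timescale recursions -/

/-- A nonnegative sequence that is eventually contracted by the factors `1 - c * β k` tends to zero
if `∑ β k` diverges. -/
theorem tendsto_zero_of_contraction {β W : ℕ → ℝ} {c : ℝ} (hc : 0 < c)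
    (hβ : Tendsto (fun N : ℕ => ∑ k ∈ Finset.range N, β k) atTop atTop)
    (hW : ∀ k, 0 ≤ W k) (hstep : ∀ᶠ k in atTop, W (k + 1) ≤ (1 - c * β k) * W k) :
    Tendsto W atTop (𝓝 0) := by
  obtain ⟨K, hK⟩ := eventually_atTop.1 hstep
  set B : ℕ → ℝ := fun N => ∑ k ∈ Finset.range N, β k with hB
  have hbound : ∀ k, K ≤ k → W k ≤ W K * Real.exp (c * B K) * Real.exp (-(c * B k)) := by
    intro k hk
    induction k, hk using Nat.le_induction with
    | base => rw [mul_assoc, ← Real.exp_add, add_neg_cancel, Real.exp_zero, mul_one]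
    | succ k hk ih =>
      have hexp : Real.exp (-(c * B (k + 1))) =
          Real.exp (-(c * β k)) * Real.exp (-(c * B k)) := by
        rw [← Real.exp_add, hB]
        congr 1
        simp only [Finset.sum_range_succ]
        ring
      have h1 : 1 - c * β k ≤ Real.exp (-(c * β k)) := by
        linarith [Real.add_one_le_exp (-(c * β k))]
      calc W (k + 1) ≤ (1 - c * β k) * W k := hK k hk
        _ ≤ Real.exp (-(c * β k)) * W k := mul_le_mul_of_nonneg_right h1 (hW k)
        _ ≤ Real.exp (-(c * β k)) * (W K * Real.exp (c * B K) * Real.exp (-(c * B k))) :=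
          mul_le_mul_of_nonneg_left ih (Real.exp_pos _).le
        _ = W K * Real.exp (c * B K) * Real.exp (-(c * B (k + 1))) := by rw [hexp]; ring
  have hlim : Tendsto (fun k => W K * Real.exp (c * B K) * Real.exp (-(c * B k))) atTop (𝓝 0) := by
    have := Real.tendsto_exp_neg_atTop_nhds_zero.comp (hβ.const_mul_atTop hc)
    simpa using this.const_mul (W K * Real.exp (c * B K))
  exact squeeze_zero' (.of_forall hW) ((eventually_ge_atTop K).mono hbound) hlim

theorem IsTwoTimescale.tendsto_zero {γ β : ℕ → ℝ} (h : IsTwoTimescale γ β) :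
    Tendsto γ atTop (𝓝 0) ∧ Tendsto β atTop (𝓝 0) := by
  have aux : ∀ u : ℕ → ℝ, (∀ k, u (k + 1) ^ 2 ≤ γ (k + 1) ^ 2 + β (k + 1) ^ 2) →
      Tendsto u atTop (𝓝 0) := by
    intro u hu
    have hsq : Tendsto (fun k => u (k + 1) ^ 2) atTop (𝓝 0) :=
      squeeze_zero (fun k => sq_nonneg _) hu h.summable_sq.tendsto_atTop_zero
    have hsqrt := hsq.sqrt
    simp only [Real.sqrt_sq_eq_abs, Real.sqrt_zero] at hsqrt
    exact (tendsto_add_atTop_iff_nat 1).1 ((tendsto_zero_iff_abs_tendsto_zero _).2 hsqrt)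
  exact ⟨aux γ fun k => le_add_of_nonneg_right (sq_nonneg _),
    aux β fun k => le_add_of_nonneg_left (sq_nonneg _)⟩

theorem IsTwoTimescale.tendsto_sum_range {γ β : ℕ → ℝ} (h : IsTwoTimescale γ β) :
    Tendsto (fun N : ℕ => ∑ k ∈ Finset.range N, β k) atTop atTop := by
  refine (tendsto_add_atTop_iff_nat 1).1 ?_
  have heq : ∀ N : ℕ, ∑ k ∈ Finset.range (N + 1), β k = β 0 + ∑ k ∈ Finset.Icc 1 N, β k := by
    intro N
    induction N with
    | zero => simp
    | succ N ih => rw [Finset.sum_range_succ, ih, Finset.sum_Icc_succ_top (by omega), add_assoc]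
  simp only [heq]
  exact tendsto_atTop_add_const_left _ _ h.incentive_sum

/-- A scalar linear two-timescale recursion, with fast variable `x`, fast rate `a` and quasi-steady
state `x = -κ * p`, tends to zero if the slow rate `1 + b * κ`, obtained by inserting the
quasi-steady state in the slow equation, is positive. -/
theorem tendsto_zero_of_twoTimescale {γ β : ℕ → ℝ} (h : IsTwoTimescale γ β) {a κ b : ℝ}
    (ha : 0 < a) (hκ : 0 ≤ κ) (hs : 0 < 1 + b * κ) {x p : ℕ → ℝ}
    (hx : ∀ k, 1 ≤ k → x (k + 1) = x k - γ k * a * (x k + κ * p k))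
    (hp : ∀ k, 1 ≤ k → p (k + 1) = p k - β k * (p k - b * x k)) :
    Tendsto x atTop (𝓝 0) ∧ Tendsto p atTop (𝓝 0) := by
  obtain ⟨s, hs_def⟩ : ∃ s, s = 1 + b * κ := ⟨_, rfl⟩
  rw [← hs_def] at hs
  obtain ⟨y, hy⟩ : ∃ y : ℕ → ℝ, ∀ k, y k = x k + κ * p k := ⟨_, fun _ => rfl⟩
  -- `C * κ ≤ 1 / 2` lets the slow contraction pay for the drift of the fast error.
  obtain ⟨C, hC, hCκ⟩ : ∃ C : ℝ, 0 < C ∧ C * κ ≤ 1 / 2 := by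
    refine ⟨1 / (2 * (κ + 1)), by positivity, ?_⟩
    rw [div_mul_eq_mul_div, div_le_div_iff₀ (by positivity) (by positivity)]
    linarith
  obtain ⟨D, hD⟩ : ∃ D, D = C * κ * |b| + |b| + C * s / 2 := ⟨_, rfl⟩
  have hDpos : 0 < D := by rw [hD]; positivity
  have hstep : ∀ᶠ k in atTop, |p (k + 1)| + C * |y (k + 1)| ≤
      (1 - s / 2 * β k) * (|p k| + C * |y k|) := by
    have hγa := (h.tendsto_zero.1.mul_const a).eventually_le_const (u := 1) (by simp)
    have hβs := (h.tendsto_zero.2.mul_const s).eventually_le_const (u := 1) (by simp)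
    have hratio := h.ratio.eventually_le_const (u := C * a / D) (by positivity)
    filter_upwards [eventually_ge_atTop 1, hγa, hβs, hratio] with k hk hγa hβs hratio
    have hγ := (h.strategy_mem k hk).1
    have hβ := (h.incentive_mem k hk).1
    rw [div_le_div_iff₀ hγ hDpos] at hratio
    have hp' : p (k + 1) = (1 - β k * s) * p k + β k * (b * y k) := by
      rw [hp k hk, hy, hs_def]; ring
    have hy' : y (k + 1) = (1 - γ k * a) * y k + β k * κ * (b * y k) - β k * κ * (s * p k) := by
      rw [hy, hx k hk, hp k hk, hy, hs_def]; ring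
    have habs : ∀ u v : ℝ, 0 ≤ u → |u * v| = u * |v| := fun u v hu => by
      rw [abs_mul, abs_of_nonneg hu]
    have h1 : |p (k + 1)| ≤ (1 - β k * s) * |p k| + β k * (|b| * |y k|) := by
      rw [hp']
      refine (abs_add_le _ _).trans_eq ?_
      rw [habs _ _ (by linarith), habs _ _ hβ.le, abs_mul]
    have h2 : |y (k + 1)| ≤
        (1 - γ k * a) * |y k| + β k * κ * (|b| * |y k|) + β k * κ * (s * |p k|) := by
      rw [hy']
      refine (abs_sub _ _).trans ((add_le_add_left (abs_add_le _ _) _).trans_eq ?_)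
      rw [habs _ _ (by linarith), habs _ _ (by positivity), habs _ (s * p k) (by positivity),
        abs_mul, habs s _ hs.le]
    have h3 : 0 ≤ (1 / 2 - C * κ) * (β k * s * |p k|) :=
      mul_nonneg (by linarith) (by positivity)
    have h4 : 0 ≤ (C * a * γ k - β k * D) * |y k| := mul_nonneg (by linarith) (abs_nonneg _)
    rw [hD] at h4
    linarith [mul_le_mul_of_nonneg_left h2 hC.le]
  have hW := tendsto_zero_of_contraction (W := fun k => |p k| + C * |y k|) (half_pos hs)
    h.tendsto_sum_range (fun k => by positivity) hstep
  have hp0 : Tendsto p atTop (𝓝 0) :=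
    squeeze_zero_norm (fun k => le_add_of_nonneg_right (by positivity)) hW
  have hy0 : Tendsto y atTop (𝓝 0) := by
    refine squeeze_zero_norm (a := fun k => C⁻¹ * (|p k| + C * |y k|)) (fun k => ?_) ?_
    · rw [mul_add, inv_mul_cancel_left₀ hC.ne']
      exact le_add_of_nonneg_left (by positivity)
    · simpa using hW.const_mul C⁻¹
  refine ⟨?_, hp0⟩
  have hx0 := hy0.sub (hp0.const_mul κ)
  simpa [hy] using hx0

theorem tendsto_of_deviation_of_sum {I : Type*} [Fintype I] {u : ℕ → I → ℝ} {c : ℝ}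
    (i : I)
    (hdev : Tendsto (fun k => Fintype.card I * u k i - ∑ j, u k j) atTop (𝓝 0))
    (hsum : Tendsto (fun k => ∑ j, u k j - Fintype.card I * c) atTop (𝓝 0)) :
    Tendsto (fun k => u k i) atTop (𝓝 c) := by
  have hn : (Fintype.card I : ℝ) ≠ 0 := by
    have : Nonempty I := ⟨i⟩
    exact_mod_cast Fintype.card_ne_zero
  have hlim := ((hdev.add hsum).const_mul (Fintype.card I : ℝ)⁻¹).add_const c
  rw [add_zero, mul_zero, zero_add] at hlim
  refine hlim.congr fun k => ?_
  field_simp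
  ring

/-! ### Equilibrium and social optimum -/

variable {I : Type*} [Fintype I]

/-- The Nash equilibrium under the incentive vector `p`: the equation
`δ * x i + δ * ∑ j, x j = θ - ν - p i` solved for `x i`, with the value of the total inserted. -/
noncomputable def nashProfile (θ δ ν : ℝ) (p : I → ℝ) : I → ℝ := fun i =>
  (θ - ν - p i) / δ -
    (Fintype.card I * (θ - ν) - ∑ j, p j) / (δ * (Fintype.card I + 1))

/-- The quantity that each firm produces at the social optimum with `n` firms. -/
noncomputable def optimalQuantity (θ δ ν lam n : ℝ) : ℝ := (θ - ν) / (2 * δ * n + 2 * lam)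

/-- The incentive that each of `n` firms faces at the social optimum. -/
noncomputable def optimalIncentive (θ δ ν lam n : ℝ) : ℝ :=
  (δ * (n - 1) + 2 * lam) * optimalQuantity θ δ ν lam n

theorem optimalQuantity_mul {θ δ ν lam n : ℝ} (hδ : 0 < δ) (hlam : 0 < lam) (hn : 0 ≤ n) :
    (2 * δ * n + 2 * lam) * optimalQuantity θ δ ν lam n = θ - ν := by
  have : 2 * δ * n + 2 * lam ≠ 0 := by positivity
  rw [optimalQuantity]
  field_simp

theorem eq_nashProfile_iff {θ δ ν : ℝ} (hδ : 0 < δ) (p x : I → ℝ) :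
    x = nashProfile θ δ ν p ↔ ∀ i, δ * x i + δ * ∑ j, x j = θ - ν - p i := by
  have hn : (0 : ℝ) < Fintype.card I + 1 := by positivity
  constructor
  · rintro rfl i
    have hsum : ∑ j, nashProfile θ δ ν p j =
        (Fintype.card I * (θ - ν) - ∑ j, p j) / (δ * (Fintype.card I + 1)) := by
      simp only [nashProfile, Finset.sum_sub_distrib, ← Finset.sum_div, Finset.sum_const,
        Finset.card_univ, nsmul_eq_mul]
      field_simp
      ring
    rw [hsum, nashProfile]
    field_simp
    ring
  · intro h
    have hsum : δ * (Fintype.card I + 1) * ∑ j, x j =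
        Fintype.card I * (θ - ν) - ∑ j, p j := by
      have := Finset.sum_congr rfl fun i (_ : i ∈ Finset.univ) => h i
      simp only [Finset.sum_add_distrib, Finset.sum_sub_distrib, ← Finset.mul_sum, Finset.sum_const,
        Finset.card_univ, nsmul_eq_mul] at this
      linear_combination this
    funext i
    rw [nashProfile, ← hsum, mul_div_cancel_left₀ _ (by positivity), ← h i]
    field_simp
    ring

/-- The social cost is the sum of its optimal value and of a positive definite quadratic form in the
distance to the optimum. -/
theorem socialCost_eq_add {θ δ ν lam : ℝ} (hδ : 0 < δ) (hlam : 0 < lam) (x : I → ℝ) :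
    socialCost θ δ ν lam x =
      socialCost θ δ ν lam (fun _ : I => optimalQuantity θ δ ν lam (Fintype.card I)) +
        (δ * (∑ i, x i - Fintype.card I * optimalQuantity θ δ ν lam (Fintype.card I)) ^ 2 +
          lam * ∑ i, (x i - optimalQuantity θ δ ν lam (Fintype.card I)) ^ 2) := by
  have hc := optimalQuantity_mul (θ := θ) (ν := ν) hδ hlam (Nat.cast_nonneg (Fintype.card I))
  simp only [socialCost_eq, sub_sq, Finset.sum_add_distrib, Finset.sum_sub_distrib,
    ← Finset.mul_sum, ← Finset.sum_mul, Finset.sum_const, Finset.card_univ, nsmul_eq_mul]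
  linear_combination (∑ i, x i - Fintype.card I *
    optimalQuantity θ δ ν lam (Fintype.card I)) * hc

theorem isSociallyOptimal_iff {θ δ ν lam : ℝ} (hδ : 0 < δ) (hlam : 0 < lam) (x : I → ℝ) :
    IsSociallyOptimal θ δ ν lam x ↔
      x = fun _ => optimalQuantity θ δ ν lam (Fintype.card I) := by
  constructor
  · intro h
    have h1 := h fun _ => optimalQuantity θ δ ν lam (Fintype.card I)
    rw [socialCost_eq_add hδ hlam x] at h1
    set c := optimalQuantity θ δ ν lam (Fintype.card I)
    have h2 : lam * ∑ i, (x i - c) ^ 2 ≤ 0 := by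
      have := mul_nonneg hδ.le (sq_nonneg (∑ i, x i - Fintype.card I * c))
      linarith
    have h3 : ∑ i, (x i - c) ^ 2 = 0 :=
      le_antisymm (nonpos_of_mul_nonpos_right h2 hlam) (Finset.sum_nonneg fun i _ => sq_nonneg _)
    funext i
    have h4 := (Finset.sum_eq_zero_iff_of_nonneg fun i _ => sq_nonneg (x i - c)).1 h3 i
      (Finset.mem_univ i)
    exact sub_eq_zero.1 (pow_eq_zero_iff two_ne_zero |>.1 h4)
  · rintro rfl y
    rw [socialCost_eq_add hδ hlam y]
    exact le_add_of_nonneg_right (by positivity)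

/-- The optimal incentive makes the social optimum an equilibrium. -/
theorem nashProfile_optimalIncentive {θ δ ν lam : ℝ} (hδ : 0 < δ) (hlam : 0 < lam) :
    nashProfile θ δ ν (fun _ : I => optimalIncentive θ δ ν lam (Fintype.card I)) =
      fun _ => optimalQuantity θ δ ν lam (Fintype.card I) := by
  refine ((eq_nashProfile_iff hδ _ _).2 fun i => ?_).symm
  have hc := optimalQuantity_mul (θ := θ) (ν := ν) hδ hlam (Nat.cast_nonneg (Fintype.card I))
  simp only [optimalIncentive, Finset.sum_const, Finset.card_univ, nsmul_eq_mul]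
  linear_combination hc

variable [DecidableEq I]

theorem sum_erase_eq_sub (x : I → ℝ) (i : I) :
    ∑ j ∈ Finset.univ.erase i, x j = ∑ j, x j - x i :=
  Finset.sum_erase_eq_sub (Finset.mem_univ i)

theorem isNash_iff {θ δ ν : ℝ} (hδ : 0 < δ) (p x : I → ℝ) :
    IsNash θ δ ν p x ↔ x = nashProfile θ δ ν p := by
  rw [eq_nashProfile_iff hδ]
  refine forall_congr' fun i => ?_
  have h := isBestResponse_iff θ δ ν hδ p x i (x i)
  rw [Function.update_eq_self] at h
  rw [h, bestResponse, sum_erase_eq_sub, eq_div_iff (by positivity)]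
  constructor <;> intro h <;> linarith

theorem eq_externality_iff {θ δ ν lam : ℝ} (hδ : 0 < δ) (hlam : 0 < lam) (p : I → ℝ) :
    p = externality θ δ ν lam (nashProfile θ δ ν p) ↔
      p = fun _ => optimalIncentive θ δ ν lam (Fintype.card I) := by
  have hc := optimalQuantity_mul (θ := θ) (ν := ν) hδ hlam (Nat.cast_nonneg (Fintype.card I))
  constructor
  · intro h
    obtain ⟨x, hx⟩ : ∃ x, x = nashProfile θ δ ν p := ⟨_, rfl⟩
    have hNash := (eq_nashProfile_iff hδ p x).1 hx
    rw [← hx] at h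
    have hp : ∀ i, p i = 2 * lam * x i + δ * (∑ j, x j - x i) := fun i => by
      rw [← sum_erase_eq_sub, ← externality_eq θ δ ν lam, ← h]
    -- Equilibrium and externality together give the first-order condition of the social optimum.
    have hfoc : ∀ i, 2 * lam * x i + 2 * δ * ∑ j, x j = θ - ν := fun i => by
      linear_combination hNash i - hp i
    have hS : ∑ j, x j = Fintype.card I * optimalQuantity θ δ ν lam (Fintype.card I) := by
      have := Finset.sum_congr rfl fun i (_ : i ∈ Finset.univ) => hfoc i
      simp only [Finset.sum_add_distrib, ← Finset.mul_sum, Finset.sum_const,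
        Finset.card_univ, nsmul_eq_mul] at this
      have hne : 2 * δ * (Fintype.card I : ℝ) + 2 * lam ≠ 0 := by positivity
      refine mul_left_cancel₀ hne ?_
      linear_combination this - Fintype.card I * hc
    funext i
    have hxi : x i = optimalQuantity θ δ ν lam (Fintype.card I) := by
      refine mul_left_cancel₀ (mul_pos two_pos hlam).ne' ?_
      linear_combination hfoc i - 2 * δ * hS - hc
    rw [hp i, hS, hxi, optimalIncentive]
    ring
  · rintro rfl
    funext i
    rw [nashProfile_optimalIncentive hδ hlam, externality_eq, sum_erase_eq_sub]
    simp only [optimalIncentive, Finset.sum_const, Finset.card_univ, nsmul_eq_mul]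
    ring

/-! ### Convergence of the learning dynamics -/

section Dynamics

variable {θ δ ν lam : ℝ} {γ β : ℕ → ℝ} {x p : ℕ → I → ℝ}

theorem IsLearningDynamics.strategy_succ (hδ : 0 < δ)
    (hd : IsLearningDynamics θ δ ν lam γ β x p) {k : ℕ} (hk : 1 ≤ k) (i : I) :
    x (k + 1) i = x k i - γ k / 2 * (x k i + ∑ j, x k j - (θ - ν - p k i) / δ) := by
  rw [hd.strategy_update k hk i, bestResponse, sum_erase_eq_sub]
  field_simp
  ring

theorem IsLearningDynamics.incentive_succ
    (hd : IsLearningDynamics θ δ ν lam γ β x p) {k : ℕ} (hk : 1 ≤ k) (i : I) :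
    p (k + 1) i = p k i - β k * (p k i - (δ * ∑ j, x k j + (2 * lam - δ) * x k i)) := by
  rw [hd.incentive_update k hk i, sum_erase_eq_sub]
  ring

theorem IsLearningDynamics.sum_strategy_succ (hδ : 0 < δ)
    (hd : IsLearningDynamics θ δ ν lam γ β x p) {k : ℕ} (hk : 1 ≤ k) :
    ∑ i, x (k + 1) i = ∑ i, x k i - γ k / 2 * ((Fintype.card I + 1) * ∑ j, x k j -
      (Fintype.card I * (θ - ν) - ∑ i, p k i) / δ) := by
  simp only [hd.strategy_succ hδ hk, Finset.sum_sub_distrib, Finset.sum_add_distrib,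
    ← Finset.mul_sum, ← Finset.sum_div, Finset.sum_const, Finset.card_univ, nsmul_eq_mul]
  ring

theorem IsLearningDynamics.sum_incentive_succ
    (hd : IsLearningDynamics θ δ ν lam γ β x p) {k : ℕ} (hk : 1 ≤ k) :
    ∑ i, p (k + 1) i = ∑ i, p k i -
      β k * (∑ i, p k i - (δ * (Fintype.card I - 1) + 2 * lam) * ∑ j, x k j) := by
  simp only [hd.incentive_succ hk, Finset.sum_sub_distrib, Finset.sum_add_distrib,
    ← Finset.mul_sum, Finset.sum_const, Finset.card_univ, nsmul_eq_mul]
  ring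

/-- The aggregate quantity and the aggregate incentive, centered at the optimum, follow a scalar
two-timescale recursion. -/
theorem IsLearningDynamics.tendsto_sum (hδ : 0 < δ) (hlam : 0 < lam) (h : IsTwoTimescale γ β)
    (hd : IsLearningDynamics θ δ ν lam γ β x p) :
    Tendsto (fun k => ∑ i, x k i - Fintype.card I * optimalQuantity θ δ ν lam (Fintype.card I))
      atTop (𝓝 0) ∧
    Tendsto (fun k => ∑ i, p k i - Fintype.card I * optimalIncentive θ δ ν lam (Fintype.card I))
      atTop (𝓝 0) := by
  have hn : (0 : ℝ) ≤ Fintype.card I := Nat.cast_nonneg _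
  have hc := optimalQuantity_mul (θ := θ) (ν := ν) hδ hlam hn
  refine tendsto_zero_of_twoTimescale h (a := (Fintype.card I + 1) / 2)
    (κ := 1 / (δ * (Fintype.card I + 1))) (b := δ * (Fintype.card I - 1) + 2 * lam)
    (by positivity) (by positivity) ?_ (fun k hk => ?_) (fun k hk => ?_)
  · have : 1 + (δ * ((Fintype.card I : ℝ) - 1) + 2 * lam) * (1 / (δ * (Fintype.card I + 1))) =
        (2 * δ * Fintype.card I + 2 * lam) / (δ * (Fintype.card I + 1)) := by
      field_simp
      ring
    rw [this]
    positivity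
  · rw [hd.sum_strategy_succ hδ hk, ← hc, optimalIncentive]
    field_simp
    ring
  · rw [hd.sum_incentive_succ hk, optimalIncentive]
    ring

/-- The deviations of a firm from the average, scaled by the number of firms, follow a scalar
two-timescale recursion. -/
theorem IsLearningDynamics.tendsto_deviation (hδ : 0 < δ) (hlam : 0 < lam)
    (h : IsTwoTimescale γ β) (hd : IsLearningDynamics θ δ ν lam γ β x p) (i : I) :
    Tendsto (fun k => Fintype.card I * x k i - ∑ j, x k j) atTop (𝓝 0) ∧
    Tendsto (fun k => Fintype.card I * p k i - ∑ j, p k j) atTop (𝓝 0) := by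
  refine tendsto_zero_of_twoTimescale h (a := 1 / 2) (κ := 1 / δ) (b := 2 * lam - δ)
    (by positivity) (by positivity) ?_ (fun k hk => ?_) (fun k hk => ?_)
  · have : 1 + (2 * lam - δ) * (1 / δ) = 2 * lam / δ := by
      field_simp
      ring
    rw [this]
    positivity
  · rw [hd.sum_strategy_succ hδ hk, hd.strategy_succ hδ hk]
    field_simp
    ring
  · rw [hd.sum_incentive_succ hk, hd.incentive_succ hk]
    ring

theorem IsLearningDynamics.tendsto (hδ : 0 < δ) (hlam : 0 < lam) (h : IsTwoTimescale γ β)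
    (hd : IsLearningDynamics θ δ ν lam γ β x p) :
    Tendsto (fun k => (x k, p k)) atTop
      (𝓝 (fun _ => optimalQuantity θ δ ν lam (Fintype.card I),
        fun _ => optimalIncentive θ δ ν lam (Fintype.card I))) := by
  have hsum := hd.tendsto_sum hδ hlam h
  have hdev := hd.tendsto_deviation hδ hlam h
  exact (tendsto_pi_nhds.2 fun i => tendsto_of_deviation_of_sum i (hdev i).1 hsum.1).prodMk_nhds
    (tendsto_pi_nhds.2 fun i => tendsto_of_deviation_of_sum i (hdev i).2 hsum.2)

end Dynamics

end Cournot

theorem proposition4 {I : Type*} [Fintype I] [DecidableEq I] (θ δ ν lam : ℝ)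
    (hθ : 0 < θ) (hδ : 0 < δ) (hlam : 0 < lam) :
    ∃ (xstar : (I → ℝ) → (I → ℝ)) (xdag pdag : I → ℝ),
      -- `xstar p` is the unique Nash equilibrium under the incentive vector `p`
      (∀ p x, Cournot.IsNash θ δ ν p x ↔ x = xstar p) ∧
      -- `xdag` is the unique socially optimal profile
      (∀ x, Cournot.IsSociallyOptimal θ δ ν lam x ↔ x = xdag) ∧
      -- `pdag` is the unique incentive vector equal to the externality at equilibrium
      (∀ p, p = Cournot.externality θ δ ν lam (xstar p) ↔ p = pdag) ∧
      -- `pdag` induces the social optimum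
      xstar pdag = xdag ∧
      -- convergence of the learning dynamics
      (δ < lam → ∀ (γ β : ℕ → ℝ), Cournot.IsTwoTimescale γ β →
        ∀ (x p : ℕ → I → ℝ), Cournot.IsLearningDynamics θ δ ν lam γ β x p →
          Tendsto (fun k => (x k, p k)) atTop (𝓝 (xdag, pdag))) :=
  ⟨Cournot.nashProfile θ δ ν, _, _, Cournot.isNash_iff hδ,
    Cournot.isSociallyOptimal_iff hδ hlam, Cournot.eq_externality_iff hδ hlam,
    Cournot.nashProfile_optimalIncentive hδ hlam,
    fun _ _ _ h _ _ hd => hd.tendsto hδ hlam h⟩
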